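/- An alternating sign matrix (ASM) is a square matrix of $0$'s, $1$'s and $-1$'s such that the nonzero entries in each row and each column alternate between $1$ and $-1$ and begin and end with $1$. Let $A(n;x)=\sum_M x^{k(M)}$, where the sum is over all $n\times n$ ASMs $M$ and $k(M)$ is the number of entries of $M$ equal to $-1$. Then for every integer $n\ge 0$ $$A(2n+1;3)=\left(3^{n(n+1)/2}\,\frac{2!\,5!\,8!\cdots(3n-1)!}{(n+1)!\,(n+2)!\cdots(2n)!}\right)^2$$ (where empty products are $1$), and for every integer $n\ge 1$ $$A(2n;3)=3^{n-1}\,\frac{(3n-1)!\,(n-1)!}{(2n-1)!^2}\,A(2n-1;3).$$ -/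

import Mathlib

open scoped Nat

/-- The nonzero entries of the sequence `v` alternate between `1` and `-1`,
and begin and end with `1`; all entries are `0`, `1` or `-1`. -/
structure IsAlternatingSignSeq {n : ℕ} (v : Fin n → ℤ) : Prop where
  /-- The entries are `0`'s, `1`'s and `-1`'s. -/
  entries : ∀ i, v i = 0 ∨ v i = 1 ∨ v i = -1
  /-- There is a nonzero entry. -/
  nonzero : ∃ i, v i ≠ 0
  /-- The first nonzero entry is `1`. -/
  first : ∀ i, v i ≠ 0 → (∀ j, j < i → v j = 0) → v i = 1
  /-- The last nonzero entry is `1`. -/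
  last : ∀ i, v i ≠ 0 → (∀ j, i < j → v j = 0) → v i = 1
  /-- Consecutive nonzero entries have opposite signs. -/
  alternate : ∀ i j, i < j → v i ≠ 0 → v j ≠ 0 →
    (∀ k, i < k → k < j → v k = 0) → v j = -v i

/-- An alternating sign matrix: every row and every column is an alternating sign sequence. -/
structure IsASM {n : ℕ} (M : Matrix (Fin n) (Fin n) ℤ) : Prop where
  row : ∀ i, IsAlternatingSignSeq (fun j => M i j)
  col : ∀ j, IsAlternatingSignSeq (fun i => M i j)

theorem finite_setOf_isASM (n : ℕ) :
    {M : Matrix (Fin n) (Fin n) ℤ | IsASM M}.Finite := by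
  have h : (Set.univ.pi fun _ : Fin n => Set.univ.pi fun _ : Fin n =>
      ({0, 1, -1} : Set ℤ)).Finite :=
    Set.Finite.pi fun _ => Set.Finite.pi fun _ => Set.toFinite _
  refine h.subset fun M hM => ?_
  intro i _ j _
  exact (hM.row i).entries j

/-- The finite set of all `n × n` alternating sign matrices. -/
noncomputable def asms (n : ℕ) : Finset (Matrix (Fin n) (Fin n) ℤ) :=
  (finite_setOf_isASM n).toFinset

/-- The number of entries of `M` equal to `-1`. -/
def numNegOnes {n : ℕ} (M : Matrix (Fin n) (Fin n) ℤ) : ℕ :=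
  (Finset.univ.filter fun p : Fin n × Fin n => M p.1 p.2 = -1).card

/-- The `x`-enumeration `A(n;x)` of `n × n` alternating sign matrices. -/
noncomputable def asmEnum {R : Type*} [CommSemiring R] (n : ℕ) (x : R) : R :=
  ∑ M ∈ asms n, x ^ numNegOnes M

/-!
Alternating sign matrices are counted as states of the six-vertex model with domain wall boundary
on an `n × n` grid. Let `ω` be a primitive cube root of unity. Give row `i` a parameter `x i`,
column `j` a parameter `y j`, and each vertex the weight `vertexWeight`; the sum over all states of
the product of the weights is `partitionFn`. At `x = 1`, `y = -1` the four vertex types that stand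
for a zero entry have weights `1, 1, -1, -1` (the signs cancel over a whole state), an entry `1` has
weight `1` and an entry `-1` has weight `3`, so that the partition function there is `A(n;3)`
(`partitionFn_one_neg_one`).

At a cube root of unity the partition function has a closed form for generic parameters,
`partitionFn_mul_jointVandermonde`: times the Vandermonde product of all `2n` variables
`z = (x, y)` it is the alternant `det (z_s ^ μ_k)` with exponents `μ = 0, 1, 3, 4, …, 3n-3, 3n-2`.
In other words, it is up to sign the Schur function of the partition `(n-1, n-1, …, 1, 1, 0, 0)`.
The proof is by induction on `n` and interpolation in `y 0`. Both sides are polynomials in `y 0` of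
degree less than `3n - 1`, and they agree at `3n - 1` points: both vanish where `y 0` is an `x i`
or another `y j`, and at `y 0 = ω x i` both reduce to size `n - 1`. For the partition function this
reduction uses that the corner vertex is forced (`partitionFn_corner`) after row `i` has been moved
to the top; rows may be exchanged by the Yang-Baxter equation (`braid_semiconjBy`,
`commute_rowTransfer`).

At `y = -x` the columns of the alternant split according to the parity of the exponents, and the
determinant factors into two alternants in `x ^ 2` of size `n`, with exponents `0, 2, 3, 5, 6, …`
and `0, 1, 3, 4, 6, …` (`exists_unit_det_gappedAlternant_neg`). For `x i = t ^ i` these are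
Vandermonde determinants, and the limit `t → 1` gives `A(n;3) ∏ (j - i) ^ 2` as a product of differences of the
exponents (`asmEnum_three_mul`). The ratios of consecutive values of `A(n;3)` are then quotients of
factorials.
-/

open Matrix
open scoped Kronecker

/-! ### The six-vertex model and the Yang-Baxter equation -/

section
variable {K : Type*} [CommRing K]

/-- The weight of a vertex with left, top, right and bottom edges `h, c, h', c'` in the six-vertex
model with row parameter `x` and column parameter `y`. The edge states record the partial sums of an
alternating sign matrix, along the row on horizontal edges and down the column on vertical ones:
the matrix entry at an admissible vertex is `h' - h = c' - c`. The gauge is chosen so that an entry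
`1` has weight `1`; the Yang-Baxter equation involves only the product of the weights of the entries
`1` and `-1`, up to a matching change of `braidMatrix`. -/
def vertexWeight (ω x y : K) : Bool → Bool → Bool → Bool → K
  | false, false, false, false => ω * y - ω ^ 2 * x
  | true, true, true, true => ω * y - ω ^ 2 * x
  | false, true, false, true => ω * x - ω ^ 2 * y
  | true, false, true, false => ω * x - ω ^ 2 * y
  | false, false, true, true => 1
  | true, true, false, false => -3 * x * y
  | _, _, _, _ => 0

/-- The vertex weights with fixed vertical edges, as a matrix from the left to the right edge. -/
def vertexMatrix (ω x y : K) (c c' : Bool) : Matrix Bool Bool K :=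
  Matrix.of fun h h' => vertexWeight ω x y h c h' c'

/-- The weight of a row with upper vertical edges `s` and lower vertical edges `s'`, summed over the
inner horizontal edges, as a matrix from the leftmost to the rightmost edge. -/
def rowMatrix {n : ℕ} (ω : K) (y : Fin n → K) (x : K) (s s' : Fin n → Bool) :
    Matrix Bool Bool K :=
  (List.ofFn fun j => vertexMatrix ω x (y j) (s j) (s' j)).prod

/-- The transfer matrix of a row whose leftmost edge is `false` and whose rightmost edge is `true`,
from the upper to the lower vertical edges. -/
def rowTransfer {n : ℕ} (ω : K) (y : Fin n → K) (x : K) :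
    Matrix (Fin n → Bool) (Fin n → Bool) K :=
  Matrix.of fun s s' => rowMatrix ω y x s s' false true

/-- The partition function with domain wall boundary: the rows have parameters `x`, from top to
bottom; the top and left edges are `false`, the bottom and right edges `true`. -/
def partitionFn {n : ℕ} (ω : K) (x : List K) (y : Fin n → K) : K :=
  (x.map (rowTransfer ω y)).prod (fun _ => false) (fun _ => true)

theorem rowMatrix_cons {n : ℕ} (ω : K) (y : Fin (n + 1) → K) (x : K) (s s' : Fin (n + 1) → Bool) :
    rowMatrix ω y x s s' = vertexMatrix ω x (y 0) (s 0) (s' 0) *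
      rowMatrix ω (Fin.tail y) x (Fin.tail s) (Fin.tail s') := by
  simp [rowMatrix, List.ofFn_succ, Fin.tail]

theorem sum_fin_succ_bool {M : Type*} [AddCommMonoid M] {n : ℕ} (f : (Fin (n + 1) → Bool) → M) :
    ∑ s, f s = ∑ b, ∑ s : Fin n → Bool, f (Fin.cons b s) := by
  rw [← (Fin.consEquiv fun _ : Fin (n + 1) => Bool).sum_comp, Fintype.sum_prod_type]
  rfl

/-- Two vertices on top of each other, with row parameters `x` and `x'`, summed over the vertical
edge between them. -/
def doubleVertexMatrix (ω x x' y : K) (c c' : Bool) : Matrix (Bool × Bool) (Bool × Bool) K :=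
  ∑ m, vertexMatrix ω x y c m ⊗ₖ vertexMatrix ω x' y m c'

/-- The R-matrix that exchanges two rows with parameters `x` and `x'`. -/
def braidMatrix (ω x x' : K) : Matrix (Bool × Bool) (Bool × Bool) K :=
  Matrix.of fun p q => match p, q with
    | (false, false), (false, false) => ω * x' - ω ^ 2 * x
    | (true, true), (true, true) => ω * x' - ω ^ 2 * x
    | (false, true), (false, true) => (ω - ω ^ 2) * x
    | (true, false), (true, false) => (ω - ω ^ 2) * x'
    | (false, true), (true, false) => x - x'
    | (true, false), (false, true) => x - x'
    | _, _ => 0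

/-- The Yang-Baxter equation: the R-matrix moves through a pair of vertices in one column and
exchanges their row parameters. -/
theorem braid_semiconjBy {ω : K} (hω : ω ^ 2 + ω + 1 = 0) (x x' y : K) (c c' : Bool) :
    SemiconjBy (braidMatrix ω x x') (doubleVertexMatrix ω x x' y c c')
      (doubleVertexMatrix ω x' x y c c') := by
  have h3 : ω ^ 3 = 1 := by linear_combination (ω - 1) * hω
  have h4 : ω ^ 4 = ω := by linear_combination ω * h3
  have h2 : ω ^ 2 = -1 - ω := by linear_combination hω
  have h5 : ω ^ 5 = -1 - ω := by linear_combination ω ^ 2 * h3 + hω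
  have h6 : ω ^ 6 = 1 := by linear_combination (ω ^ 3 + 1) * h3
  ext ⟨a, b⟩ ⟨d, e⟩
  simp only [Matrix.mul_apply, Fintype.sum_prod_type, doubleVertexMatrix, braidMatrix,
    vertexMatrix, Matrix.add_apply, kroneckerMap_apply, Fintype.sum_bool, Matrix.of_apply]
  cases c <;> cases c' <;> cases a <;> cases b <;> cases d <;> cases e <;>
    simp only [vertexWeight, mul_zero, zero_mul, add_zero, zero_add] <;>
    ring_nf <;> simp only [h6, h5, h4, h3, h2] <;> ring

/-- Two adjacent rows, summed over the vertical edges between them, are a product over the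
columns. -/
theorem sum_kronecker_rowMatrix {n : ℕ} (ω : K) (y : Fin n → K) (x x' : K)
    (s s' : Fin n → Bool) :
    ∑ m, rowMatrix ω y x s m ⊗ₖ rowMatrix ω y x' m s' =
      (List.ofFn fun j => doubleVertexMatrix ω x x' (y j) (s j) (s' j)).prod := by
  induction n with
  | zero => simp [rowMatrix]
  | succ n ih =>
    rw [sum_fin_succ_bool, List.ofFn_succ, List.prod_cons]
    have := ih (Fin.tail y) (Fin.tail s) (Fin.tail s')
    simp only [Fin.tail] at this
    rw [← this, doubleVertexMatrix, Finset.sum_mul_sum]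
    refine Finset.sum_congr rfl fun b _ => Finset.sum_congr rfl fun m _ => ?_
    rw [rowMatrix_cons, rowMatrix_cons, ← mul_kronecker_mul]
    simp

theorem semiconjBy_list_prod_ofFn {M : Type*} [Monoid M] {a : M} {n : ℕ} {f g : Fin n → M}
    (h : ∀ j, SemiconjBy a (f j) (g j)) :
    SemiconjBy a (List.ofFn f).prod (List.ofFn g).prod := by
  induction n with
  | zero => simp
  | succ n ih =>
    simp only [List.ofFn_succ, List.prod_cons]
    exact (h 0).mul_right (ih fun j => h j.succ)

/-- Transfer matrices commute: the Yang-Baxter equation carries the R-matrix through two whole rows,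
and on the boundary edges `(false, false)` and `(true, true)` it acts by the same scalar. -/
theorem commute_rowTransfer [IsDomain K] {n : ℕ} {ω : K} (hω : ω ^ 2 + ω + 1 = 0) (y : Fin n → K)
    {x x' : K} (hx : ω * x' - ω ^ 2 * x ≠ 0) :
    Commute (rowTransfer ω y x) (rowTransfer ω y x') := by
  ext s s'
  have h := semiconjBy_list_prod_ofFn (a := braidMatrix ω x x')
    (fun j => braid_semiconjBy hω x x' (y j) (s j) (s' j))
  rw [← sum_kronecker_rowMatrix, ← sum_kronecker_rowMatrix] at h
  have h' := congrFun (congrFun h.eq (false, false)) (true, true)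
  simp only [Matrix.mul_apply, Fintype.sum_prod_type, braidMatrix, Matrix.sum_apply,
    kroneckerMap_apply, Fintype.sum_bool, Matrix.of_apply] at h'
  simp only [zero_mul, mul_zero, add_zero, zero_add] at h'
  rw [mul_comm _ (ω * x' - ω ^ 2 * x)] at h'
  simpa [Matrix.mul_apply, rowTransfer] using mul_left_cancel₀ hx h'

theorem partitionFn_perm [IsDomain K] {n : ℕ} {ω : K} (hω : ω ^ 2 + ω + 1 = 0) (y : Fin n → K)
    {l l' : List K} (hp : l.Perm l')
    (hl : l.Pairwise fun x x' => ω * x' - ω ^ 2 * x ≠ 0) :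
    partitionFn ω l y = partitionFn ω l' y := by
  rw [partitionFn, partitionFn, (hp.map _).prod_eq']
  rw [List.pairwise_map]
  exact hl.imp fun h => commute_rowTransfer hω y h

end

/-! ### Recursion at the corner and degree in a column parameter -/

section
variable {K : Type*} [CommRing K]

/-- Below empty vertical edges, a row entered by an occupied edge is frozen. -/
theorem rowMatrix_true_of_top_false {n : ℕ} (ω : K) (y : Fin n → K) (x : K) (s : Fin n → Bool) :
    rowMatrix ω y x (fun _ => false) s true true =
      if s = fun _ => false then ∏ j, (ω * x - ω ^ 2 * y j) else 0 := by
  induction n with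
  | zero => simp [rowMatrix, Subsingleton.elim s fun _ => false]
  | succ n ih =>
    obtain ⟨b, s, rfl⟩ : ∃ b s', s = Fin.cons b s' := ⟨s 0, Fin.tail s, (Fin.cons_self_tail s).symm⟩
    have hs : (Fin.cons b s : Fin (n + 1) → Bool) = (fun _ => false) ↔
        b = false ∧ s = fun _ => false := by
      rw [← Fin.cons_self_tail (fun _ : Fin (n + 1) => false), Fin.cons_inj]
      rfl
    have ih' := ih (Fin.tail y) s
    have ht : Fin.tail (fun _ : Fin (n + 1) => false) = fun _ => false := rfl
    rw [rowMatrix_cons, Matrix.mul_apply, Fintype.sum_bool, ht, Fin.tail_cons, ih']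
    cases b <;> simp [vertexMatrix, vertexWeight, hs, Fin.prod_univ_succ, Fin.tail]

/-- If the first column parameter is `ω x`, the entry `0` is excluded in the corner, and the whole
first row is frozen. -/
theorem rowTransfer_corner {n : ℕ} (ω : K) (y : Fin n → K) (x : K)
    (s : Fin (n + 1) → Bool) :
    rowTransfer ω (Fin.cons (ω * x) y : Fin (n + 1) → K) x (fun _ => false) s =
      if s = Fin.cons true (fun _ => false) then ∏ j, (ω * x - ω ^ 2 * y j) else 0 := by
  obtain ⟨b, s, rfl⟩ : ∃ b s', s = Fin.cons b s' := ⟨s 0, Fin.tail s, (Fin.cons_self_tail s).symm⟩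
  have ht : Fin.tail (fun _ : Fin (n + 1) => false) = fun _ => false := rfl
  rw [rowTransfer, Matrix.of_apply, rowMatrix_cons, Matrix.mul_apply, Fintype.sum_bool, ht,
    Fin.tail_cons, Fin.tail_cons, rowMatrix_true_of_top_false]
  have h0 : ω * (ω * x) - ω ^ 2 * x = 0 := by ring
  cases b <;> simp [vertexMatrix, vertexWeight, h0]

/-- In the first column an occupied vertical edge stays occupied. -/
theorem rowTransfer_cons_true {n : ℕ} (ω : K) (y : Fin n → K) (y₀ x : K)
    (s : Fin n → Bool) (s' : Fin (n + 1) → Bool) :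
    rowTransfer ω (Fin.cons y₀ y : Fin (n + 1) → K) x (Fin.cons true s) s' =
      if s' 0 = true then (ω * x - ω ^ 2 * y₀) * rowTransfer ω y x s (Fin.tail s') else 0 := by
  rw [rowTransfer, Matrix.of_apply, rowMatrix_cons, Matrix.mul_apply, Fintype.sum_bool]
  cases h : s' 0 <;> simp [vertexMatrix, vertexWeight, rowTransfer]

theorem prod_rowTransfer_cons_true {n : ℕ} (ω : K) (y : Fin n → K) (y₀ : K) (l : List K)
    (s s' : Fin n → Bool) :
    (l.map (rowTransfer ω (Fin.cons y₀ y : Fin (n + 1) → K))).prod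
        (Fin.cons true s) (Fin.cons true s') =
      (l.map fun x => ω * x - ω ^ 2 * y₀).prod * (l.map (rowTransfer ω y)).prod s s' := by
  induction l generalizing s with
  | nil => simp [Matrix.one_apply]
  | cons x l ih =>
    simp only [List.map_cons, List.prod_cons, Matrix.mul_apply, sum_fin_succ_bool,
      rowTransfer_cons_true, Fin.cons_zero, Fin.tail_cons, Fintype.sum_bool]
    simp only [if_true, ih, Finset.mul_sum]
    simp only [Bool.false_eq_true, if_false, zero_mul, Finset.sum_const_zero, add_zero]
    exact Finset.sum_congr rfl fun m _ => by ring

/-- At `y 0 = ω x` the first row and the first column are frozen, with entry `1` in the corner, and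
what remains is the partition function of the smaller grid. -/
theorem partitionFn_corner {n : ℕ} (ω : K) (y : Fin n → K) (x : K) (l : List K) :
    partitionFn ω (x :: l) (Fin.cons (ω * x) y : Fin (n + 1) → K) =
      (∏ j, (ω * x - ω ^ 2 * y j)) * (l.map fun x' => ω * x' - ω ^ 2 * (ω * x)).prod *
        partitionFn ω l y := by
  rw [partitionFn, List.map_cons, List.prod_cons, Matrix.mul_apply]
  simp only [rowTransfer_corner, ite_mul, zero_mul, Finset.sum_ite_eq', Finset.mem_univ, if_true]
  have ht : (fun _ => true : Fin (n + 1) → Bool) = Fin.cons true (fun _ => true) := by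
    rw [← Fin.cons_self_tail (fun _ : Fin (n + 1) => true)]; rfl
  rw [ht, prod_rowTransfer_cons_true, partitionFn, mul_assoc]

open Polynomial in
/-- As the first column parameter `t` varies, the partition function is a polynomial in `t` of
degree less than the number of rows: each vertex in the first column contributes degree at most one,
and the one where the vertical edge changes contributes a constant. -/
theorem exists_polynomial_prod_rowTransfer {n : ℕ} (ω : K) (y : Fin n → K) (l : List K)
    (s s' : Fin n → Bool) :
    (∃ p : K[X], p.degree < (l.length : WithBot ℕ) ∧ ∀ t, p.eval t =
      (l.map (rowTransfer ω (Fin.cons t y : Fin (n + 1) → K))).prod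
        (Fin.cons false s) (Fin.cons true s')) := by
  induction l generalizing s with
  | nil =>
    refine ⟨0, by simp, fun t => ?_⟩
    simp [Fin.cons_inj]
  | cons x l ih =>
    choose p hp hpe using ih
    obtain ⟨q, hq, hqe⟩ : ∃ q : K[X], q.degree ≤ (l.length : WithBot ℕ) ∧ ∀ t, q.eval t =
        (l.map fun x => ω * x - ω ^ 2 * t).prod := by
      refine ⟨(l.map fun x => C (ω * x) - C (ω ^ 2) * X).prod, ?_, fun t => ?_⟩
      · refine (degree_list_prod_le _).trans ?_
        rw [List.map_map]
        refine (List.sum_le_card_nsmul _ 1 ?_).trans (by simp)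
        simp only [List.mem_map, Function.comp, forall_exists_index, and_imp]
        rintro _ x' _ rfl
        compute_degree
      · rw [← coe_evalRingHom, map_list_prod, List.map_map]
        simp [Function.comp_def]
    refine ⟨∑ m, (C (rowMatrix ω y x s m false true) * (C ω * X - C (ω ^ 2 * x)) * p m +
        C (rowMatrix ω y x s m true true * (l.map (rowTransfer ω y)).prod m s') * q), ?_, ?_⟩
    · rw [degree_lt_iff_coeff_zero]
      intro k hk
      rw [finsetSum_coeff]
      refine Finset.sum_eq_zero fun m _ => ?_
      rw [coeff_add, mul_assoc, coeff_C_mul, coeff_C_mul, sub_mul, coeff_sub, mul_assoc,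
        coeff_C_mul, coeff_C_mul]
      simp only [List.length_cons] at hk
      obtain ⟨k, rfl⟩ : ∃ k', k = k' + 1 := ⟨k - 1, by omega⟩
      have h1 : (p m).coeff k = 0 := coeff_eq_zero_of_degree_lt
        ((hp m).trans_le (by exact_mod_cast Nat.le_of_succ_le_succ hk))
      have h2 : (p m).coeff (k + 1) = 0 := coeff_eq_zero_of_degree_lt
        ((hp m).trans_le (by exact_mod_cast (Nat.le_of_succ_le hk)))
      have h3 : q.coeff (k + 1) = 0 := coeff_eq_zero_of_degree_lt
        (hq.trans_lt (by exact_mod_cast hk))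
      simp [h1, h2, h3]
    · intro t
      rw [List.map_cons, List.prod_cons, Matrix.mul_apply, sum_fin_succ_bool, Fintype.sum_bool,
        ← Finset.sum_add_distrib, eval_finsetSum]
      refine Finset.sum_congr rfl fun m _ => ?_
      rw [prod_rowTransfer_cons_true, ← hpe, ← hqe]
      simp only [rowTransfer, Matrix.of_apply, rowMatrix_cons, Matrix.mul_apply, Fintype.sum_bool,
        Fin.cons_zero, Fin.tail_cons, vertexMatrix, vertexWeight]
      simp
      ring

end

/-! ### Alternants and Vandermonde products -/

section
variable {K : Type*} [CommRing K]

/-- The matrix of powers of the variables `(x, y)` with exponents `0, 3, 6, …` in the columns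
`inl k` and `1, 4, 7, …` in the columns `inr k`. -/
def gappedAlternant {n : ℕ} (x y : Fin n → K) : Matrix (Fin n ⊕ Fin n) (Fin n ⊕ Fin n) K :=
  Matrix.of fun s k => Sum.elim x y s ^ Sum.elim (fun k : Fin n => 3 * k.val)
    (fun k : Fin n => 3 * k.val + 1) k

/-- The Vandermonde product of the combined variables `(x, y)`. -/
def jointVandermonde {n m : ℕ} (x : Fin n → K) (y : Fin m → K) : K :=
  (vandermonde x).det * (vandermonde y).det * ∏ i, ∏ j, (y j - x i)

theorem det_vandermonde_fin_cons {n : ℕ} (t : K) (x : Fin n → K) :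
    (vandermonde (Fin.cons t x : Fin (n + 1) → K)).det =
      (∏ j, (x j - t)) * (vandermonde x).det := by
  rw [det_vandermonde, det_vandermonde, Fin.prod_univ_succ, Fin.prod_Ioi_zero]
  simp [Fin.prod_Ioi_succ]

theorem jointVandermonde_cons_right {n m : ℕ} (x : Fin n → K) (t : K) (y : Fin m → K) :
    jointVandermonde x (Fin.cons t y : Fin (m + 1) → K) =
      (∏ j, (y j - t)) * (∏ i, (t - x i)) * jointVandermonde x y := by
  simp only [jointVandermonde, det_vandermonde_fin_cons, Fin.prod_univ_succ, Fin.cons_zero,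
    Fin.cons_succ, Finset.prod_mul_distrib]
  ring

theorem jointVandermonde_cons_left {n m : ℕ} (x : Fin n → K) (t : K) (y : Fin m → K) :
    jointVandermonde (Fin.cons t x : Fin (n + 1) → K) y =
      (∏ i, (x i - t)) * (∏ j, (y j - t)) * jointVandermonde x y := by
  simp only [jointVandermonde, det_vandermonde_fin_cons, Fin.prod_univ_succ, Fin.cons_zero,
    Fin.cons_succ]
  ring

theorem jointVandermonde_comp_perm {n m : ℕ} (x : Fin n → K) (y : Fin m → K)
    (σ : Equiv.Perm (Fin n)) :
    jointVandermonde (x ∘ σ) y = Equiv.Perm.sign σ * jointVandermonde x y := by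
  have h : vandermonde (x ∘ σ) = (vandermonde x).submatrix σ id := rfl
  rw [jointVandermonde, jointVandermonde, h, det_permute,
    ← Equiv.prod_comp σ (fun i => ∏ j, (y j - x i))]
  simp only [Function.comp]
  ring

theorem det_gappedAlternant_comp_perm {n : ℕ} (x y : Fin n → K) (σ : Equiv.Perm (Fin n)) :
    (gappedAlternant (x ∘ σ) y).det = Equiv.Perm.sign σ * (gappedAlternant x y).det := by
  have h : gappedAlternant (x ∘ σ) y =
      (gappedAlternant x y).submatrix (Equiv.Perm.sumCongr σ 1) id := by
    ext s k
    cases s <;> simp [gappedAlternant]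
  rw [h, det_permute, Equiv.Perm.sign_sumCongr]
  simp

/-- The unitriangular matrix that subtracts from each column but the first `c` times its
predecessor. -/
def shiftColumns (n : ℕ) (c : K) : Matrix (Fin (n + 1)) (Fin (n + 1)) K :=
  Matrix.of fun k k' => (if k = k' then 1 else 0) -
    Fin.cases 0 (fun j : Fin n => if k = j.castSucc then c else 0) k'

theorem det_shiftColumns (n : ℕ) (c : K) : (shiftColumns n c).det = 1 := by
  rw [det_of_isUpperTriangular]
  · refine Finset.prod_eq_one fun k _ => ?_
    induction k using Fin.cases with
    | zero => simp [shiftColumns]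
    | succ j => simp [shiftColumns, Fin.castSucc_lt_succ.ne']
  · intro k k' h
    simp only [id] at h
    induction k' using Fin.cases with
    | zero => simp [shiftColumns, h.ne']
    | succ j => simp [shiftColumns, h.ne', (Fin.castSucc_lt_succ.trans h).ne']

theorem sum_mul_shiftColumns_zero (n : ℕ) (c : K) (f : Fin (n + 1) → K) :
    ∑ k, f k * shiftColumns n c k 0 = f 0 := by
  simp [shiftColumns]

theorem sum_mul_shiftColumns_succ (n : ℕ) (c : K) (f : Fin (n + 1) → K) (j : Fin n) :
    ∑ k, f k * shiftColumns n c k j.succ = f j.succ - c * f j.castSucc := by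
  simp [shiftColumns, mul_sub, mul_comm]

/-- In the basis `1, t, (t³ - a³) tᵐ` of the span of the column monomials, the rows of `a` and `ω a`
vanish except in the columns of `1` and `t`, which gives a block triangular determinant. -/
theorem det_gappedAlternant_corner {n : ℕ} {ω : K} (hω : ω ^ 3 = 1) (a : K) (x y : Fin n → K) :
    (gappedAlternant (Fin.cons a x : Fin (n + 1) → K) (Fin.cons (ω * a) y : Fin (n + 1) → K)).det =
      (ω - 1) * a * (∏ i, (x i ^ 3 - a ^ 3)) * (∏ j, (y j ^ 3 - a ^ 3)) *
        (gappedAlternant x y).det := by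
  set U := shiftColumns n (a ^ 3)
  set M := gappedAlternant (Fin.cons a x : Fin (n + 1) → K) (Fin.cons (ω * a) y : Fin (n + 1) → K)
    with hM
  let e₁ : Fin (n + 1) ≃ Fin n ⊕ Unit := (finSuccEquiv n).trans (Equiv.optionEquivSumPUnit _)
  let e : Fin (n + 1) ⊕ Fin (n + 1) ≃ (Fin n ⊕ Fin n) ⊕ (Unit ⊕ Unit) :=
    (Equiv.sumCongr e₁ e₁).trans (Equiv.sumSumSumComm _ _ _ _)
  have hU : (M * fromBlocks U 0 0 U).det = M.det := by
    rw [det_mul, det_fromBlocks_zero₂₁, det_shiftColumns]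
    simp
  let z : Fin n ⊕ Fin n → K := Sum.elim x y
  let C : Matrix (Fin n ⊕ Fin n) (Unit ⊕ Unit) K :=
    Matrix.of fun s k => Sum.elim (fun _ => 1) (fun _ => z s) k
  let A : Matrix (Unit ⊕ Unit) (Unit ⊕ Unit) K :=
    fromBlocks 1 (Matrix.of fun _ _ => a) (Matrix.of fun _ _ => 1) (Matrix.of fun _ _ => ω * a)
  have hω3 : (ω * a) ^ 3 = a ^ 3 := by rw [mul_pow, hω, one_mul]
  have hblock : (M * fromBlocks U 0 0 U).submatrix e.symm e.symm =
      fromBlocks (diagonal (fun s => z s ^ 3 - a ^ 3) * gappedAlternant x y) C 0 A := by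
    have h3 : ∀ (w : K) (j : ℕ), w ^ (3 * (j + 1)) - a ^ 3 * w ^ (3 * j) =
        (w ^ 3 - a ^ 3) * w ^ (3 * j) := fun w j => by ring
    have h4 : ∀ (w : K) (j : ℕ), w ^ (3 * (j + 1) + 1) - a ^ 3 * w ^ (3 * j + 1) =
        (w ^ 3 - a ^ 3) * w ^ (3 * j + 1) := fun w j => by ring
    ext s k
    rcases s with (i | i) | (i | i) <;> rcases k with (k | k) | (k | k) <;>
      simp [e, e₁, Matrix.mul_apply, U, sum_mul_shiftColumns_zero, sum_mul_shiftColumns_succ,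
        hM, gappedAlternant, z, C, A, h3, h4, hω3, diagonal_apply]
  rw [← hU, ← det_submatrix_equiv_self e.symm, hblock, det_fromBlocks_zero₂₁, det_mul,
    det_diagonal, det_fromBlocks_one₁₁, Fintype.prod_sum_type]
  simp [z, Matrix.mul_apply]
  ring

end

/-! ### The partition function at a cube root of unity -/

section
variable {K : Type*} [Field K]

/-- The closed form passes from size `n` to size `n + 1` where the corner is frozen. The three
linear factors contributed by each remaining parameter `z` make up `z³ - a³`. -/
theorem partitionFn_mul_jointVandermonde_corner {n : ℕ} {ω : K} (hω : ω ^ 2 + ω + 1 = 0) (a : K)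
    (x y : Fin n → K)
    (ih : partitionFn ω (List.ofFn x) y * jointVandermonde x y = (gappedAlternant x y).det) :
    partitionFn ω (a :: List.ofFn x) (Fin.cons (ω * a) y : Fin (n + 1) → K) *
        jointVandermonde (Fin.cons a x : Fin (n + 1) → K) (Fin.cons (ω * a) y : Fin (n + 1) → K) =
      (gappedAlternant (Fin.cons a x : Fin (n + 1) → K)
        (Fin.cons (ω * a) y : Fin (n + 1) → K)).det := by
  have hω3 : ω ^ 3 = 1 := by linear_combination (ω - 1) * hω
  rw [partitionFn_corner, jointVandermonde_cons_right, jointVandermonde_cons_left,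
    det_gappedAlternant_corner hω3, ← ih, List.map_ofFn, List.prod_ofFn]
  have hcube : ∀ z, (z - ω * a) * (z - a) * (z - ω ^ 2 * a) = z ^ 3 - a ^ 3 := fun z => by
    linear_combination (-z ^ 2 * a + ω * z * a ^ 2 - (ω - 1) * a ^ 3) * hω
  have hy : (∏ j, (ω * a - ω ^ 2 * y j)) * (∏ j, (y j - ω * a)) * (∏ j, (y j - a)) =
      (-ω ^ 2) ^ n * ∏ j, (y j ^ 3 - a ^ 3) := by
    rw [← Fin.prod_const n (-ω ^ 2)]
    simp only [← Finset.prod_mul_distrib]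
    refine Finset.prod_congr rfl fun j _ => ?_
    linear_combination (-ω ^ 2) * hcube (y j) - ω * a * (y j - ω * a) * (y j - a) * hω3
  have hx : (∏ i, (ω * x i - ω ^ 2 * (ω * a))) * (∏ i, (x i - a)) * (∏ i, (ω * a - x i)) =
      (-ω) ^ n * ∏ i, (x i ^ 3 - a ^ 3) := by
    rw [← Fin.prod_const n (-ω)]
    simp only [← Finset.prod_mul_distrib]
    refine Finset.prod_congr rfl fun i _ => ?_
    linear_combination (-ω) * hcube (x i)
  have hc : (-ω ^ 2) ^ n * (-ω) ^ n = 1 := by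
    rw [← mul_pow, show -ω ^ 2 * -ω = ω ^ 3 by ring, hω3, one_pow]
  simp only [Function.comp, Fin.prod_univ_succ, Fin.cons_zero, Fin.cons_succ]
  linear_combination (jointVandermonde x y * partitionFn ω (List.ofFn x) y * (ω - 1) * a) *
    (congrArg₂ (· * ·) hy hx + (∏ j, (y j ^ 3 - a ^ 3)) * (∏ i, (x i ^ 3 - a ^ 3)) * hc)

open Polynomial in
theorem exists_polynomial_partitionFn {n : ℕ} (ω : K) (x : List K) (y : Fin n → K) :
    ∃ p : K[X], p.degree < (x.length : WithBot ℕ) ∧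
      ∀ t, p.eval t = partitionFn ω x (Fin.cons t y : Fin (n + 1) → K) := by
  obtain ⟨p, hp, hpe⟩ := exists_polynomial_prod_rowTransfer ω y x (fun _ => false) (fun _ => true)
  refine ⟨p, hp, fun t => ?_⟩
  rw [hpe, partitionFn, ← Fin.cons_self_tail (fun _ : Fin (n + 1) => false),
    ← Fin.cons_self_tail (fun _ : Fin (n + 1) => true)]
  rfl

open Polynomial in
theorem exists_polynomial_jointVandermonde {n m : ℕ} (x : Fin n → K) (y : Fin m → K) :
    ∃ p : K[X], p.degree ≤ ((m + n : ℕ) : WithBot ℕ) ∧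
      ∀ t, p.eval t = jointVandermonde x (Fin.cons t y : Fin (m + 1) → K) := by
  refine ⟨(∏ j, (C (y j) - X)) * (∏ i, (X - C (x i))) * C (jointVandermonde x y), ?_, fun t => ?_⟩
  · have h1 : (∏ j, (C (y j) - X)).degree ≤ (m : WithBot ℕ) := by
      refine (degree_prod_le _ _).trans ((Finset.sum_le_card_nsmul _ _ 1 fun j _ => ?_).trans ?_)
      · compute_degree
      · simp
    have h2 : (∏ i, (X - C (x i))).degree ≤ (n : WithBot ℕ) := by
      refine (degree_prod_le _ _).trans ((Finset.sum_le_card_nsmul _ _ 1 fun j _ => ?_).trans ?_)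
      · compute_degree
      · simp
    have h3 := degree_C_le (a := jointVandermonde x y)
    have h4 := (degree_mul_le_of_le (degree_mul_le_of_le h1 h2) h3)
    simpa using h4
  · simp [jointVandermonde_cons_right, eval_prod]

open Polynomial in
theorem exists_polynomial_det_gappedAlternant {n : ℕ} (x : Fin (n + 1) → K) (y : Fin n → K) :
    ∃ p : K[X], p.degree < ((3 * n + 2 : ℕ) : WithBot ℕ) ∧
      ∀ t, p.eval t = (gappedAlternant x (Fin.cons t y : Fin (n + 1) → K)).det := by
  set M := gappedAlternant x (Fin.cons 0 y : Fin (n + 1) → K) with hM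
  let e : Fin (n + 1) ⊕ Fin (n + 1) → ℕ := Sum.elim (fun k => 3 * k.val) (fun k => 3 * k.val + 1)
  have he : ∀ k, e k < 3 * n + 2 := by
    rintro (k | k) <;> simp [e] <;> omega
  refine ⟨∑ k, C ((Mᵀ).adjugate (Sum.inr 0) k) * X ^ e k, ?_, fun t => ?_⟩
  · refine (degree_sum_le _ _).trans_lt ?_
    rw [Finset.sup_lt_iff (WithBot.bot_lt_coe _)]
    intro k _
    exact (degree_C_mul_X_pow_le _ _).trans_lt (by exact_mod_cast he k)
  · have h : gappedAlternant x (Fin.cons t y : Fin (n + 1) → K) =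
        M.updateRow (Sum.inr 0) (fun k => t ^ e k) := by
      ext s k
      rcases s with i | j
      · simp [hM, gappedAlternant]
      · induction j using Fin.cases with
        | zero => simp [gappedAlternant, e]
        | succ j => simp [hM, gappedAlternant]
    rw [h, ← cramer_transpose_apply, cramer_eq_adjugate_mulVec]
    simp [Matrix.mulVec, dotProduct, eval_finsetSum]

/-- The closed form of the partition function at a primitive cube root of unity. -/
theorem partitionFn_mul_jointVandermonde {n : ℕ} {ω : K} (hω : ω ^ 2 + ω + 1 = 0) (hω1 : ω ≠ 1)
    (x y : Fin n → K) (hxy : Function.Injective fun s => Sum.elim x y s ^ 3)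
    (hx : ∀ i, x i ≠ 0) :
    partitionFn ω (List.ofFn x) y * jointVandermonde x y = (gappedAlternant x y).det := by
  have hω3 : ω ^ 3 = 1 := by linear_combination (ω - 1) * hω
  induction n with
  | zero =>
    simp [partitionFn, jointVandermonde,
      Subsingleton.elim (fun _ : Fin 0 => true) fun _ => false]
  | succ n ih =>
    obtain ⟨t, y, rfl⟩ : ∃ t y', y = Fin.cons t y' := ⟨y 0, Fin.tail y, (Fin.cons_self_tail y).symm⟩
    have hxx : ∀ i j, x i ^ 3 = x j ^ 3 → i = j := fun i j h => by
      simpa using @hxy (Sum.inl i) (Sum.inl j) h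
    have hyy : ∀ i j, y i ^ 3 = y j ^ 3 → i = j := fun i j h => by
      simpa using @hxy (Sum.inr i.succ) (Sum.inr j.succ) (by simpa using h)
    have hxy' : ∀ i j, x i ^ 3 ≠ y j ^ 3 := fun i j h => by
      simpa using @hxy (Sum.inl i) (Sum.inr j.succ) (by simpa using h)
    -- Rows may be exchanged, so it suffices to treat the corner in the first row.
    have hcorner : ∀ i, partitionFn ω (List.ofFn x) (Fin.cons (ω * x i) y : Fin (n + 1) → K) *
        jointVandermonde x (Fin.cons (ω * x i) y : Fin (n + 1) → K) =
        (gappedAlternant x (Fin.cons (ω * x i) y : Fin (n + 1) → K)).det := by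
      intro i
      set σ := Equiv.swap 0 i
      have hσ0 : (x ∘ σ) 0 = x i := by simp [σ]
      have hσ : x ∘ σ = Fin.cons (x i) (Fin.tail (x ∘ σ)) := by
        rw [← hσ0, Fin.cons_self_tail]
      have h := partitionFn_mul_jointVandermonde_corner hω (x i) (Fin.tail (x ∘ σ)) y
        (ih _ _ ?_ fun j => hx _)
      · rw [← hσ, jointVandermonde_comp_perm, det_gappedAlternant_comp_perm] at h
        have hp : (x i :: List.ofFn (Fin.tail (x ∘ σ))) = List.ofFn (x ∘ σ) := by
          rw [List.ofFn_succ, hσ0]; rfl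
        rw [hp, partitionFn_perm hω _ (σ.ofFn_comp_perm x)] at h
        · have hs : ((Equiv.Perm.sign σ : ℤ) : K) * ((Equiv.Perm.sign σ : ℤ) : K) = 1 := by
            rw [← Int.cast_mul, Int.units_coe_mul_self, Int.cast_one]
          linear_combination ((Equiv.Perm.sign σ : ℤ) : K) * h - (partitionFn ω (List.ofFn x)
            (Fin.cons (ω * x i) y : Fin (n + 1) → K) *
            jointVandermonde x (Fin.cons (ω * x i) y : Fin (n + 1) → K) -
            (gappedAlternant x (Fin.cons (ω * x i) y : Fin (n + 1) → K)).det) * hs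
        · rw [List.pairwise_ofFn]
          intro j k hjk h0
          refine hjk.ne (σ.injective (hxx _ _ ?_))
          have hω0 : ω ≠ 0 := by rintro rfl; simp at hω
          have h1 : x (σ k) = ω * x (σ j) := mul_left_cancel₀ hω0 (by
            simp only [Function.comp] at h0; linear_combination h0)
          rw [h1, mul_pow, hω3, one_mul]
      · rintro (j | j) (k | k) h
        · simpa using hxx _ _ h
        · exact absurd h (hxy' _ _)
        · exact absurd h.symm (hxy' _ _)
        · simpa using hyy _ _ h
    obtain ⟨p, hp, hpe⟩ := exists_polynomial_partitionFn ω (List.ofFn x) y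
    obtain ⟨q, hq, hqe⟩ := exists_polynomial_jointVandermonde x y
    obtain ⟨r, hr, hre⟩ := exists_polynomial_det_gappedAlternant x y
    -- The `3 n + 2` interpolation points in the variable `y 0`.
    let v : Fin (n + 1) ⊕ (Fin n ⊕ Fin (n + 1)) → K := Sum.elim x (Sum.elim y fun i => ω * x i)
    have hωx : ∀ i, (ω * x i) ^ 3 = x i ^ 3 := fun i => by rw [mul_pow, hω3, one_mul]
    have hωne : ∀ i j, x i ≠ ω * x j := by
      intro i j h
      obtain rfl := hxx i j (by rw [h, hωx])
      exact hω1 (mul_right_cancel₀ (hx i) (by rw [← h, one_mul]))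
    have hv : Function.Injective v := by
      rintro (i | i | i) (j | j | j) h <;> simp only [v, Sum.elim_inl, Sum.elim_inr] at h
      · rw [hxx i j (by rw [h])]
      · exact absurd (congrArg (· ^ 3) h) (hxy' _ _)
      · exact absurd h (hωne _ _)
      · exact absurd (congrArg (· ^ 3) h.symm) (hxy' _ _)
      · rw [hyy i j (by rw [h])]
      · refine absurd ?_ (hxy' j i)
        rw [h, hωx]
      · exact absurd h.symm (hωne _ _)
      · refine absurd ?_ (hxy' i j)
        rw [← h, hωx]
      · rw [hxx i j (by rw [← hωx, h, hωx])]
    have hpq : p * q = r := by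
      refine Polynomial.eq_of_degrees_lt_of_eval_index_eq Finset.univ hv.injOn ?_ ?_ ?_
      · have hp' : p.degree ≤ (n : WithBot ℕ) := by
          rw [Polynomial.degree_le_iff_coeff_zero]
          rw [List.length_ofFn, Polynomial.degree_lt_iff_coeff_zero] at hp
          exact fun k hk => hp k (by exact_mod_cast hk)
        refine (Polynomial.degree_mul_le_of_le hp' hq).trans_lt ?_
        rw [Finset.card_univ]
        simp only [Fintype.card_sum, Fintype.card_fin]
        exact_mod_cast (by omega)
      · refine hr.trans_le ?_
        rw [Finset.card_univ]
        simp only [Fintype.card_sum, Fintype.card_fin]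
        exact_mod_cast (by omega)
      · rintro (i | j | i) -
        · rw [Polynomial.eval_mul, hqe, hre, jointVandermonde_cons_right,
            Finset.prod_eq_zero (f := fun k => v (Sum.inl i) - x k) (Finset.mem_univ i)
              (by simp [v])]
          rw [det_zero_of_row_eq (i := Sum.inl i) (j := Sum.inr 0) (by simp)]
          · simp
          · ext k; simp [gappedAlternant, v]
        · rw [Polynomial.eval_mul, hqe, hre, jointVandermonde_cons_right,
            Finset.prod_eq_zero (f := fun k => y k - v (Sum.inr (Sum.inl j))) (Finset.mem_univ j)
              (by simp [v])]
          rw [det_zero_of_row_eq (i := Sum.inr j.succ) (j := Sum.inr 0) (by simp)]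
          · simp
          · ext k; simp [gappedAlternant, v]
        · rw [Polynomial.eval_mul, hpe, hqe, hre]
          exact hcorner i
    rw [← hpe, ← hqe, ← hre, ← Polynomial.eval_mul, hpq]

end

/-! ### Opposite row and column parameters -/

section
variable {K : Type*} [CommRing K]

/-- The involution of the columns of `gappedAlternant` that exchanges `inl k` and `inr k` for odd
`k`. It brings the even exponents into the left half and the odd ones into the right half. -/
def parityColumnPerm (n : ℕ) : Equiv.Perm (Fin n ⊕ Fin n) :=
  Function.Involutive.toPerm
    (Sum.elim (fun k => if Even k.val then Sum.inl k else Sum.inr k)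
      (fun k => if Even k.val then Sum.inr k else Sum.inl k)) <| by
    rintro (k | k) <;> by_cases hk : Even k.val <;> simp [hk]

theorem parityColumnPerm_inl {n : ℕ} (k : Fin n) : parityColumnPerm n (Sum.inl k) =
    if Even k.val then Sum.inl k else Sum.inr k := rfl

theorem parityColumnPerm_inr {n : ℕ} (k : Fin n) : parityColumnPerm n (Sum.inr k) =
    if Even k.val then Sum.inr k else Sum.inl k := rfl

theorem det_fromBlocks_neg {n : ℕ} (P Q : Matrix (Fin n) (Fin n) K) :
    (fromBlocks P Q P (-Q)).det = (-2) ^ n * P.det * Q.det := by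
  have h : fromBlocks P Q P (-Q) = fromBlocks 1 0 1 1 * fromBlocks P Q 0 ((-2 : K) • Q) := by
    rw [fromBlocks_multiply]
    congr 1
    · simp
    · simp
    · simp
    · ext i j
      simp
      ring
  rw [h, det_mul, det_fromBlocks_zero₁₂, det_fromBlocks_zero₂₁, det_smul]
  simp
  ring

/-- At `y = -x` the alternant factors according to the parity of the exponents. The even ones are
`2 ((3 k + 1) / 2)` and the odd ones `2 (3 k / 2) + 1`, with division in `ℕ`. -/
theorem exists_unit_det_gappedAlternant_neg (n : ℕ) : ∃ ε : ℤˣ, ∀ x : Fin n → K,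
    (gappedAlternant x (-x)).det = ((ε : ℤ) : K) * (2 ^ n * (∏ i, x i) *
      (Matrix.of fun i k : Fin n => (x i ^ 2) ^ ((3 * k.val + 1) / 2)).det *
      (Matrix.of fun i k : Fin n => (x i ^ 2) ^ (3 * k.val / 2)).det) := by
  refine ⟨Equiv.Perm.sign (parityColumnPerm n) * (-1) ^ n, fun x => ?_⟩
  have hblock : (gappedAlternant x (-x)).submatrix id (parityColumnPerm n) =
      fromBlocks (Matrix.of fun i k : Fin n => (x i ^ 2) ^ ((3 * k.val + 1) / 2))
        (diagonal x * Matrix.of fun i k : Fin n => (x i ^ 2) ^ (3 * k.val / 2))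
        (Matrix.of fun i k : Fin n => (x i ^ 2) ^ ((3 * k.val + 1) / 2))
        (-(diagonal x * Matrix.of fun i k : Fin n => (x i ^ 2) ^ (3 * k.val / 2))) := by
    have he : ∀ k : ℕ, Even k →
        3 * k = 2 * ((3 * k + 1) / 2) ∧ 3 * k + 1 = 2 * (3 * k / 2) + 1 := by
      rintro k ⟨r, rfl⟩; omega
    have ho : ∀ k : ℕ, ¬ Even k →
        3 * k + 1 = 2 * ((3 * k + 1) / 2) ∧ 3 * k = 2 * (3 * k / 2) + 1 := by
      intro k hk
      obtain ⟨r, rfl⟩ := Nat.not_even_iff_odd.mp hk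
      omega
    have hsq : ∀ (w : K) (m : ℕ), w * w ^ (2 * m) = w ^ (2 * m + 1) :=
      fun w m => (pow_succ' _ _).symm
    ext s k
    rcases s with i | i <;> rcases k with k | k <;> by_cases hk : Even k.val <;>
      simp only [parityColumnPerm_inl, parityColumnPerm_inr, gappedAlternant, submatrix_apply,
        Sum.elim_inl, Sum.elim_inr, hk, if_true, if_false, id, Matrix.of_apply, fromBlocks_apply₁₁,
        fromBlocks_apply₁₂, fromBlocks_apply₂₁, fromBlocks_apply₂₂, Matrix.neg_apply, diagonal_mul,
        hsq, ← pow_mul, Pi.neg_apply]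
    · rw [← (he _ hk).1]
    · rw [← (ho _ hk).1]
    · rw [← (he _ hk).2]
    · rw [← (ho _ hk).2]
    · rw [← (he _ hk).1, Even.neg_pow (hk.mul_left 3)]
    · rw [Even.neg_pow ⟨_, (ho _ hk).1.trans (two_mul _)⟩, ← (ho _ hk).1]
    · rw [Odd.neg_pow ⟨_, (he _ hk).2⟩, ← (he _ hk).2]
    · rw [Odd.neg_pow ⟨_, (ho _ hk).2⟩, ← (ho _ hk).2]
  have hp := det_permute' (parityColumnPerm n) (gappedAlternant x (-x))
  rw [hblock, det_fromBlocks_neg, det_mul, det_diagonal] at hp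
  have hs : ((Equiv.Perm.sign (parityColumnPerm n) : ℤ) : K) *
      ((Equiv.Perm.sign (parityColumnPerm n) : ℤ) : K) = 1 := by
    rw [← Int.cast_mul, Int.units_coe_mul_self, Int.cast_one]
  have h2 : (-2 : K) ^ n = (-1) ^ n * 2 ^ n := by rw [← mul_pow]; norm_num
  rw [h2] at hp
  push_cast
  linear_combination -((Equiv.Perm.sign (parityColumnPerm n) : ℤ) : K) * hp -
    (gappedAlternant x (-x)).det * hs

theorem exists_unit_jointVandermonde_neg (n : ℕ) : ∃ ε : ℤˣ, ∀ x : Fin n → K,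
    jointVandermonde x (-x) = ((ε : ℤ) : K) * (2 ^ n * (∏ i, x i) *
      (vandermonde fun i => x i ^ 2).det ^ 2) := by
  induction n with
  | zero => exact ⟨1, fun x => by simp [jointVandermonde]⟩
  | succ n ih =>
    obtain ⟨ε, hε⟩ := ih
    refine ⟨-((-1) ^ n * ε), fun x => ?_⟩
    obtain ⟨a, x, rfl⟩ : ∃ a x', x = Fin.cons a x' := ⟨x 0, Fin.tail x, (Fin.cons_self_tail x).symm⟩
    have hneg : -(Fin.cons a x : Fin (n + 1) → K) = Fin.cons (-a) (-x) := by
      ext i; induction i using Fin.cases <;> simp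
    have hsq : (fun i => (Fin.cons a x : Fin (n + 1) → K) i ^ 2) =
        Fin.cons (a ^ 2) (fun i => x i ^ 2) := by
      ext i; induction i using Fin.cases <;> simp
    rw [hneg, jointVandermonde_cons_right, jointVandermonde_cons_left, hε, hsq,
      det_vandermonde_fin_cons]
    simp only [Fin.prod_univ_succ, Fin.cons_zero, Fin.cons_succ, Pi.neg_apply]
    have h : (∏ j, (-x j - -a)) * (∏ i, (-a - x i)) * (∏ i, (x i - a)) * (∏ j, (-x j - a)) =
        (-1) ^ n * (∏ i, (x i ^ 2 - a ^ 2)) ^ 2 := by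
      rw [← Fin.prod_const n (-1 : K), ← Finset.prod_pow]
      simp only [← Finset.prod_mul_distrib]
      exact Finset.prod_congr rfl fun j _ => by ring
    push_cast
    linear_combination (-2 * a * (ε : ℤ) * (2 ^ n * (∏ i, x i) *
      (vandermonde fun i => x i ^ 2).det ^ 2)) * h

end

section
variable {K : Type*} [Field K]

/-- The closed form at `y = -x`. The sign depends on `n` only, which lets `x` vary afterwards. -/
theorem exists_unit_partitionFn_neg [NeZero (2 : K)] {ω : K} (hω : ω ^ 2 + ω + 1 = 0)
    (hω1 : ω ≠ 1) (n : ℕ) : ∃ ε : ℤˣ, ∀ x : Fin n → K,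
    (Function.Injective fun s => Sum.elim x (-x) s ^ 3) → (∀ i, x i ≠ 0) →
    partitionFn ω (List.ofFn x) (-x) * (vandermonde fun i => x i ^ 2).det ^ 2 =
      ((ε : ℤ) : K) * ((Matrix.of fun i k : Fin n => (x i ^ 2) ^ ((3 * k.val + 1) / 2)).det *
      (Matrix.of fun i k : Fin n => (x i ^ 2) ^ (3 * k.val / 2)).det) := by
  obtain ⟨ε₁, h₁⟩ := exists_unit_det_gappedAlternant_neg (K := K) n
  obtain ⟨ε₂, h₂⟩ := exists_unit_jointVandermonde_neg (K := K) n
  refine ⟨ε₂ * ε₁, fun x hxx hx => ?_⟩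
  have h := partitionFn_mul_jointVandermonde hω hω1 x (-x) hxx hx
  rw [h₁, h₂] at h
  have hs : ((ε₂ : ℤ) : K) * ((ε₂ : ℤ) : K) = 1 := by
    rw [← Int.cast_mul, Int.units_coe_mul_self, Int.cast_one]
  have hc : (2 : K) ^ n * ∏ i, x i ≠ 0 :=
    mul_ne_zero (pow_ne_zero _ (NeZero.ne _)) (Finset.prod_ne_zero_iff.mpr fun i _ => hx i)
  apply mul_left_cancel₀ hc
  push_cast
  linear_combination ((ε₂ : ℤ) : K) * h - (2 : K) ^ n * (∏ i, x i) *
    partitionFn ω (List.ofFn x) (-x) * (vandermonde fun i => x i ^ 2).det ^ 2 * hs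

end

/-! ### Alternating sign sequences as path increments -/

/-- An entry of a product of matrices is a sum over paths. -/
theorem prod_ofFn_apply {R S : Type*} [CommSemiring R] [Fintype S] [DecidableEq S] {n : ℕ}
    (A : Fin n → Matrix S S R) (s s' : S) :
    (List.ofFn A).prod s s' = ∑ p : Fin (n + 1) → S,
      if p 0 = s ∧ p (Fin.last n) = s' then ∏ i, A i (p i.castSucc) (p i.succ) else 0 := by
  induction n generalizing s with
  | zero =>
    rw [← (Equiv.funUnique (Fin 1) S).symm.sum_comp]
    simp only [List.ofFn_zero, List.prod_nil, Matrix.one_apply]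
    by_cases h : s = s'
    · subst h; simp
    · rw [if_neg h, Finset.sum_eq_zero]
      intro t _
      refine if_neg ?_
      rintro ⟨h1, h2⟩
      exact h (h1.symm.trans h2)
  | succ n ih =>
    rw [List.ofFn_succ, List.prod_cons, Matrix.mul_apply,
      ← (Fin.consEquiv fun _ : Fin (n + 2) => S).sum_comp, Fintype.sum_prod_type]
    simp only [ih, Finset.mul_sum]
    rw [Finset.sum_comm]
    conv_rhs => rw [Finset.sum_comm]
    refine Finset.sum_congr rfl fun p _ => ?_
    rw [Finset.sum_eq_single (p 0) (fun t _ ht => by simp [ht.symm]) (by simp),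
      Finset.sum_eq_single s (fun t _ ht => by simp [ht]) (by simp)]
    simp [Fin.prod_univ_succ, ← Fin.succ_last]

theorem sum_fin_succ_sub_castSucc {n : ℕ} (f : Fin (n + 1) → ℤ) :
    ∑ i : Fin n, (f i.succ - f i.castSucc) = f (Fin.last n) - f 0 := by
  have h := (Fin.sum_univ_succ f).symm.trans (Fin.sum_univ_castSucc f)
  rw [Finset.sum_sub_distrib]
  linarith

theorem Bool.eq_of_toInt_eq {a b : Bool} (h : a.toInt = b.toInt) : a = b := by
  cases a <;> cases b <;> simp_all

/-- A path is constant where its increments vanish. -/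
theorem eq_of_forall_between_eq_zero {n : ℕ} {v : Fin n → ℤ} {p : Fin (n + 1) → Bool}
    (hp : ∀ j, (p j.succ).toInt - (p j.castSucc).toInt = v j) (a b : Fin (n + 1)) (hab : a ≤ b)
    (hv : ∀ k : Fin n, a ≤ k.castSucc → k.succ ≤ b → v k = 0) : p a = p b := by
  induction b using Fin.induction with
  | zero => rw [Fin.le_zero_iff.mp hab]
  | succ j ih =>
    rcases hab.eq_or_lt with rfl | hlt
    · rfl
    · have hj : a ≤ j.castSucc := Fin.le_castSucc_iff.mpr hlt
      rw [ih hj fun k h1 h2 => hv k h1 (h2.trans Fin.castSucc_lt_succ.le)]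
      have := hp j
      rw [hv j hj le_rfl] at this
      exact Bool.eq_of_toInt_eq (by omega)

theorem exists_last_ne_zero {n : ℕ} (v : Fin n → ℤ) (k : Fin (n + 1))
    (h : ∃ i : Fin n, i.castSucc < k ∧ v i ≠ 0) :
    ∃ i : Fin n, i.castSucc < k ∧ v i ≠ 0 ∧ ∀ j, i < j → j.castSucc < k → v j = 0 := by
  obtain ⟨i, hi, hmax⟩ := Finset.exists_max_image
    (Finset.univ.filter fun i : Fin n => i.castSucc < k ∧ v i ≠ 0) id
    (by obtain ⟨i, hi⟩ := h; exact ⟨i, by simpa using hi⟩)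
  simp only [Finset.mem_filter, Finset.mem_univ, true_and, id] at hi hmax
  refine ⟨i, hi.1, hi.2, fun j hij hjk => ?_⟩
  by_contra hj
  exact absurd (hmax j ⟨hjk, hj⟩) (not_le.mpr hij)

/-- Alternating sign sequences are the increments of the `0`-`1` paths from `0` to `1`; the path is
given by the partial sums. -/
theorem isAlternatingSignSeq_iff {n : ℕ} (v : Fin n → ℤ) :
    IsAlternatingSignSeq v ↔ ∃ p : Fin (n + 1) → Bool, p 0 = false ∧ p (Fin.last n) = true ∧
      ∀ j, (p j.succ).toInt - (p j.castSucc).toInt = v j := by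
  classical
  constructor
  · intro hv
    let Q : Fin (n + 1) → Prop := fun k =>
      ∃ i : Fin n, i.castSucc < k ∧ v i = 1 ∧ ∀ j, i < j → j.castSucc < k → v j = 0
    refine ⟨fun k => decide (Q k), by simp [Q], ?_, fun j => ?_⟩
    · obtain ⟨i, hi⟩ := hv.nonzero
      obtain ⟨i, h1, h2, h3⟩ := exists_last_ne_zero v (Fin.last n) ⟨i, Fin.castSucc_lt_last i, hi⟩
      simp only [decide_eq_true_eq]
      exact ⟨i, h1, hv.last i h2 fun j hj => h3 j hj (Fin.castSucc_lt_last j),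
        fun j hj _ => h3 j hj (Fin.castSucc_lt_last j)⟩
    · have hlt : ∀ i : Fin n, i.castSucc < j.succ ↔ i < j ∨ i = j := fun i => by
        rw [Fin.castSucc_lt_succ_iff, le_iff_lt_or_eq]
      rcases hv.entries j with h0 | h1 | h1
      · have : Q j.succ ↔ Q j.castSucc := by
          constructor
          · rintro ⟨i, hi, hi1, hi0⟩
            refine ⟨i, ?_, hi1, fun k hk hkj => hi0 k hk (hkj.trans Fin.castSucc_lt_succ)⟩
            rcases (hlt i).mp hi with h | rfl
            · simpa using h
            · omega
          · rintro ⟨i, hi, hi1, hi0⟩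
            refine ⟨i, hi.trans Fin.castSucc_lt_succ, hi1, fun k hk hkj => ?_⟩
            rcases (hlt k).mp hkj with h | rfl
            · exact hi0 k hk (by simpa using h)
            · exact h0
        simp [this, h0]
      · have hs : Q j.succ := ⟨j, Fin.castSucc_lt_succ, h1, fun k hk hkj => by
          rcases (hlt k).mp hkj with h | rfl
          · exact absurd h hk.asymm
          · exact absurd hk (lt_irrefl _)⟩
        have hc : ¬ Q j.castSucc := by
          rintro ⟨i, hi, hi1, hi0⟩
          have := hv.alternate i j (by simpa using hi) (by omega) (by omega)
            fun k hk hkj => hi0 k hk (by simpa using hkj)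
          omega
        simp [hs, hc, h1]
      · have hs : ¬ Q j.succ := by
          rintro ⟨i, hi, hi1, hi0⟩
          rcases (hlt i).mp hi with h | rfl
          · have := hi0 j h Fin.castSucc_lt_succ
            omega
          · omega
        have hc : Q j.castSucc := by
          obtain ⟨i, hij, hi, hi0⟩ := exists_last_ne_zero v j.castSucc (by
            by_contra hno
            push Not at hno
            have := hv.first j (by omega) fun i hi => hno i (by simpa using hi)
            omega)
          refine ⟨i, hij, ?_, hi0⟩
          have := hv.alternate i j (by simpa using hij) hi (by omega)
            fun k hk hkj => hi0 k hk (by simpa using hkj)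
          omega
        simp [hs, hc, h1]
  · rintro ⟨p, h0, h1, hp⟩
    have hpj : ∀ b : Bool, b.toInt = 0 ∨ b.toInt = 1 := by decide
    refine ⟨fun i => ?_, ?_, fun i hi hz => ?_, fun i hi hz => ?_, fun i j hij hi hj hz => ?_⟩
    · have := hp i
      rcases hpj (p i.succ) with h | h <;> rcases hpj (p i.castSucc) with h' | h' <;> omega
    · by_contra! hno
      have := eq_of_forall_between_eq_zero hp 0 (Fin.last n) (Fin.zero_le _) fun k _ _ => hno k
      simp [h0, h1] at this
    · have h2 := eq_of_forall_between_eq_zero hp 0 i.castSucc (Fin.zero_le _) fun k _ hk =>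
        hz k (Fin.succ_le_castSucc_iff.mp hk)
      have := hp i
      rw [← h2, h0] at this
      rcases hpj (p i.succ) with h | h <;> simp [h] at this <;> omega
    · have h2 := eq_of_forall_between_eq_zero hp i.succ (Fin.last n) (Fin.le_last _) fun k hk _ =>
        hz k (Fin.succ_le_castSucc_iff.mp hk)
      have := hp i
      rw [h2, h1] at this
      rcases hpj (p i.castSucc) with h | h <;> simp [h] at this <;> omega
    · have h2 := eq_of_forall_between_eq_zero hp i.succ j.castSucc
        (Fin.succ_le_castSucc_iff.mpr hij) fun k hk hkj =>
        hz k (Fin.succ_le_castSucc_iff.mp hk) (Fin.succ_le_castSucc_iff.mp hkj)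
      have hi' := hp i
      have hj' := hp j
      rw [h2] at hi'
      rcases hpj (p i.castSucc) with h | h <;> rcases hpj (p j.castSucc) with h' | h' <;>
        rcases hpj (p j.succ) with h'' | h'' <;> omega

/-! ### Alternating sign matrices as six-vertex states -/

/-- The domain wall boundary condition for the edges of an `m × n` grid. A configuration of edges is
a pair of the vertical edges (`s.1 k j` is the edge of column `j` below `k` rows) and the horizontal
ones (`s.2 i k` is the edge of row `i` to the right of `k` columns). -/
def IsDomainWall {m n : ℕ} (s : (Fin (m + 1) → Fin n → Bool) × (Fin m → Fin (n + 1) → Bool)) :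
    Prop :=
  (s.1 0 = (fun _ => false) ∧ s.1 (Fin.last m) = fun _ => true) ∧
    ∀ i, s.2 i 0 = false ∧ s.2 i (Fin.last n) = true

instance {m n : ℕ} : DecidablePred (IsDomainWall (m := m) (n := n)) := fun _ =>
  inferInstanceAs (Decidable (_ ∧ _))

/-- The partition function as a sum over edge configurations. Those which are not admissible at some
vertex have weight zero. -/
theorem partitionFn_eq_sum {K : Type*} [CommRing K] {m n : ℕ} (ω : K) (x : Fin m → K)
    (y : Fin n → K) :
    partitionFn ω (List.ofFn x) y =
      ∑ s : (Fin (m + 1) → Fin n → Bool) × (Fin m → Fin (n + 1) → Bool),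
        if IsDomainWall s then ∏ i, ∏ j, vertexWeight ω (x i) (y j) (s.2 i j.castSucc)
          (s.1 i.castSucc j) (s.2 i j.succ) (s.1 i.succ j) else 0 := by
  rw [partitionFn, List.map_ofFn, prod_ofFn_apply, Fintype.sum_prod_type]
  refine Finset.sum_congr rfl fun c _ => ?_
  by_cases hc : c 0 = (fun _ => false) ∧ c (Fin.last m) = fun _ => true
  · simp only [IsDomainWall, hc, true_and, and_self, Function.comp, rowTransfer, rowMatrix,
      Matrix.of_apply, prod_ofFn_apply, Finset.prod_univ_sum, Fintype.piFinset_univ, vertexMatrix]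
    refine Finset.sum_congr rfl fun h _ => ?_
    by_cases hh : ∀ i, h i 0 = false ∧ h i (Fin.last n) = true
    · rw [if_pos hh]
      exact Finset.prod_congr rfl fun i _ => if_pos (hh i)
    · rw [if_neg hh]
      obtain ⟨i, hi⟩ := not_forall.mp hh
      exact Finset.prod_eq_zero (Finset.mem_univ i) (if_neg hi)
  · rw [if_neg hc, Finset.sum_eq_zero]
    exact fun h _ => if_neg fun hs => hc hs.1

theorem vertexWeight_eq_zero {K : Type*} [CommRing K] (ω x y : K) {h c h' c' : Bool}
    (hi : h'.toInt - h.toInt ≠ c'.toInt - c.toInt) : vertexWeight ω x y h c h' c' = 0 := by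
  revert hi
  cases h <;> cases c <;> cases h' <;> cases c' <;> simp [vertexWeight]

/-- At `x = 1`, `y = -1` an entry `-1` has weight `3`, and all other weights are signs. -/
theorem vertexWeight_one_neg_one {K : Type*} [CommRing K] {ω : K} (hω : ω ^ 2 + ω + 1 = 0)
    {h c h' c' : Bool} (hi : h'.toInt - h.toInt = c'.toInt - c.toInt) :
    vertexWeight ω 1 (-1) h c h' c' =
      (-1) ^ h.toNat * (-1) ^ c.toNat * 3 ^ (if c'.toInt - c.toInt = -1 then 1 else 0) := by
  revert hi
  cases h <;> cases c <;> cases h' <;> cases c' <;> simp [vertexWeight] <;>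
    first | linear_combination hω | linear_combination -hω

/-- If all column sums of a matrix are `1`, the partial row sums up to column `k` add up to `k`. -/
theorem sum_toNat_eq {m n : ℕ} (p : Fin m → Fin (n + 1) → Bool) (h0 : ∀ i, p i 0 = false)
    (h1 : ∀ j : Fin n, ∑ i, ((p i j.succ).toInt - (p i j.castSucc).toInt) = 1) (k : Fin (n + 1)) :
    ∑ i, (p i k).toNat = k.val := by
  have hcast : ∀ b : Bool, ((b.toNat : ℕ) : ℤ) = b.toInt := by decide
  zify
  simp only [hcast]
  induction k using Fin.induction with
  | zero => simp [h0]
  | succ j ih =>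
    have := h1 j
    rw [Finset.sum_sub_distrib, ih] at this
    simp only [Fin.val_succ, Fin.val_castSucc] at this ⊢
    push_cast
    linarith

/-- Every vertex is admissible: the horizontal and the vertical edges have the same increment, which
is the entry of the matrix. -/
def IsIce {m n : ℕ} (s : (Fin (m + 1) → Fin n → Bool) × (Fin m → Fin (n + 1) → Bool)) : Prop :=
  ∀ i j, (s.2 i j.succ).toInt - (s.2 i j.castSucc).toInt =
    (s.1 i.succ j).toInt - (s.1 i.castSucc j).toInt

instance {m n : ℕ} : DecidablePred (IsIce (m := m) (n := n)) := fun _ =>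
  inferInstanceAs (Decidable (∀ _, _))

/-- The signs of the weights cancel over a whole configuration: both the horizontal and the vertical
edges contribute `(-1) ^ (0 + 1 + ⋯ + (n - 1))`. -/
theorem prod_vertexWeight_one_neg_one {K : Type*} [CommRing K] {ω : K} (hω : ω ^ 2 + ω + 1 = 0)
    {n : ℕ} (s : (Fin (n + 1) → Fin n → Bool) × (Fin n → Fin (n + 1) → Bool))
    (hs : IsDomainWall s) (hi : IsIce s) :
    ∏ i, ∏ j, vertexWeight ω 1 (-1) (s.2 i j.castSucc) (s.1 i.castSucc j) (s.2 i j.succ)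
        (s.1 i.succ j) =
      3 ^ numNegOnes (Matrix.of fun i j => (s.1 i.succ j).toInt - (s.1 i.castSucc j).toInt) := by
  have hh : ∀ k, ∑ i, (s.2 i k).toNat = k.val := sum_toNat_eq s.2 (fun i => (hs.2 i).1) fun j => by
    simp only [hi _ j]
    rw [sum_fin_succ_sub_castSucc (fun i => (s.1 i j).toInt), hs.1.1, hs.1.2]
    rfl
  have hc : ∀ k, ∑ j, (s.1 k j).toNat = k.val :=
    sum_toNat_eq (fun j k => s.1 k j) (fun j => by rw [hs.1.1]) fun i => by
      simp only [← hi i]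
      rw [sum_fin_succ_sub_castSucc (fun j => (s.2 i j).toInt), (hs.2 i).1, (hs.2 i).2]
      rfl
  simp only [vertexWeight_one_neg_one hω (hi _ _), Finset.prod_mul_distrib]
  rw [Finset.prod_comm]
  simp only [Finset.prod_pow_eq_pow_sum, hh, hc, Fin.val_castSucc]
  rw [← mul_pow, neg_one_mul, neg_neg, one_pow, one_mul, numNegOnes, Finset.card_filter,
    Fintype.sum_prod_type]
  rfl

/-- At `x = 1`, `y = -1` the partition function is the `3`-enumeration. -/
theorem partitionFn_one_neg_one {K : Type*} [CommRing K] {ω : K} (hω : ω ^ 2 + ω + 1 = 0) (n : ℕ) :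
    partitionFn ω (List.ofFn fun _ : Fin n => 1) (fun _ : Fin n => -1) = asmEnum n (3 : K) := by
  rw [partitionFn_eq_sum, ← Finset.sum_filter, asmEnum]
  rw [← Finset.sum_filter_add_sum_filter_not _ IsIce, Finset.filter_filter]
  have h0 : ∀ s ∈ (Finset.univ.filter IsDomainWall).filter
      (fun s : (Fin (n + 1) → Fin n → Bool) × (Fin n → Fin (n + 1) → Bool) => ¬ IsIce s),
      ∏ i, ∏ j, vertexWeight ω 1 (-1) (s.2 i j.castSucc) (s.1 i.castSucc j) (s.2 i j.succ)
        (s.1 i.succ j) = 0 := by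
    intro s hs
    have hs := (Finset.mem_filter.mp hs).2
    simp only [IsIce, not_forall] at hs
    obtain ⟨i, j, hij⟩ := hs
    exact Finset.prod_eq_zero (Finset.mem_univ i) (Finset.prod_eq_zero (Finset.mem_univ j)
      (vertexWeight_eq_zero _ _ _ hij))
  rw [Finset.sum_eq_zero h0, add_zero]
  refine Finset.sum_bij
    (fun s _ => Matrix.of fun i j : Fin n => (s.1 i.succ j).toInt - (s.1 i.castSucc j).toInt)
    ?_ ?_ ?_ ?_
  · intro s hs
    obtain ⟨hb, hi⟩ := (Finset.mem_filter.mp hs).2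
    rw [asms, Set.Finite.mem_toFinset]
    refine ⟨fun i => ?_, fun j => ?_⟩
    · exact (isAlternatingSignSeq_iff _).mpr ⟨s.2 i, (hb.2 i).1, (hb.2 i).2, hi i⟩
    · exact (isAlternatingSignSeq_iff _).mpr ⟨fun k => s.1 k j, congrFun hb.1.1 j,
        congrFun hb.1.2 j, fun i => rfl⟩
  · intro s hs s' hs' h
    obtain ⟨hb, hi⟩ := (Finset.mem_filter.mp hs).2
    obtain ⟨hb', hi'⟩ := (Finset.mem_filter.mp hs').2
    have hM : ∀ i j : Fin n, (s.1 i.succ j).toInt - (s.1 i.castSucc j).toInt =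
        (s'.1 i.succ j).toInt - (s'.1 i.castSucc j).toInt := fun i j => congrFun (congrFun h i) j
    refine Prod.ext (funext fun k => funext fun j => ?_) (funext fun i => funext fun k => ?_)
    · induction k using Fin.induction with
      | zero => rw [hb.1.1, hb'.1.1]
      | succ i ih =>
        have := hM i j
        rw [ih] at this
        exact Bool.eq_of_toInt_eq (by omega)
    · induction k using Fin.induction with
      | zero => rw [(hb.2 i).1, (hb'.2 i).1]
      | succ j ih =>
        have := hM i j
        rw [← hi, ← hi', ih] at this
        exact Bool.eq_of_toInt_eq (by omega)
  · intro M hM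
    rw [asms, Set.Finite.mem_toFinset] at hM
    choose h h0 h1 hh using fun i => (isAlternatingSignSeq_iff _).mp (hM.row i)
    choose c c0 c1 hc using fun j => (isAlternatingSignSeq_iff _).mp (hM.col j)
    refine ⟨(fun k j => c j k, h), ?_, ?_⟩
    · simp only [Finset.mem_filter, Finset.mem_univ, true_and]
      exact ⟨⟨⟨funext c0, funext c1⟩, fun i => ⟨h0 i, h1 i⟩⟩, fun i j => by rw [hh, hc]⟩
    · ext i j
      exact hc j i
  · intro s hs
    obtain ⟨hb, hi⟩ := (Finset.mem_filter.mp hs).2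
    exact prod_vertexWeight_one_neg_one hω s hb hi

/-! ### The homogeneous limit -/

/-- The product over `i < j < n` of `[f j] - [f i]`, where `[a] = 1 + s + ⋯ + s ^ (a - 1)`. At
`s = 1` it is the product of the differences `f j - f i`. -/
def geomDifferenceProd {K : Type*} [CommRing K] (s : K) (n : ℕ) (f : ℕ → ℕ) : K :=
  ∏ i : Fin n, ∏ j ∈ Finset.Ioi i,
    (∑ k ∈ Finset.range (f j), s ^ k - ∑ k ∈ Finset.range (f i), s ^ k)

/-- The factors `s - 1`, which vanish in the limit `s → 1`, are separated; their number does not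
depend on `f`. -/
theorem det_vandermonde_pow {K : Type*} [CommRing K] (s : K) (n : ℕ) (f : ℕ → ℕ) :
    (vandermonde fun k : Fin n => s ^ f k).det =
      (∏ i : Fin n, ∏ _j ∈ Finset.Ioi i, (s - 1)) * geomDifferenceProd s n f := by
  rw [det_vandermonde, geomDifferenceProd, ← Finset.prod_mul_distrib]
  refine Finset.prod_congr rfl fun i _ => ?_
  rw [← Finset.prod_mul_distrib]
  refine Finset.prod_congr rfl fun j _ => ?_
  rw [mul_sub, mul_geom_sum, mul_geom_sum]
  ring

theorem continuous_vertexWeight {T : Type*} [TopologicalSpace T] (ω : ℂ) {x y : T → ℂ}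
    (hx : Continuous x) (hy : Continuous y) (h c h' c' : Bool) :
    Continuous fun t => vertexWeight ω (x t) (y t) h c h' c' := by
  cases h <;> cases c <;> cases h' <;> cases c' <;> simp only [vertexWeight] <;> fun_prop

/-- The closed form at `x i = t ^ i`, `y i = -t ^ i`, in the limit `t → 1`. -/
theorem exists_unit_asmEnum_three (n : ℕ) : ∃ ε : ℤˣ,
    asmEnum n (3 : ℂ) * geomDifferenceProd (1 : ℂ) n id ^ 2 =
      ((ε : ℤ) : ℂ) * (geomDifferenceProd (1 : ℂ) n (fun k => (3 * k + 1) / 2) *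
        geomDifferenceProd (1 : ℂ) n (fun k => 3 * k / 2)) := by
  obtain ⟨ω, hω⟩ : ∃ ω : ℂ, ω ^ 2 + ω + 1 = 0 := by
    obtain ⟨ω, hω⟩ := IsAlgClosed.exists_root
      (Polynomial.X ^ 2 + Polynomial.X + 1 : Polynomial ℂ) (by
        have : (Polynomial.X ^ 2 + Polynomial.X + 1 : Polynomial ℂ).degree = 2 := by
          compute_degree!
        rw [this]; decide)
    exact ⟨ω, by simpa using hω⟩
  have hω1 : ω ≠ 1 := by rintro rfl; norm_num at hω
  obtain ⟨ε, hε⟩ := exists_unit_partitionFn_neg hω hω1 n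
  refine ⟨ε, ?_⟩
  let F : ℝ → ℂ := fun t => partitionFn ω (List.ofFn fun i : Fin n => (t : ℂ) ^ i.val)
    (fun i : Fin n => -(t : ℂ) ^ i.val)
  have hF : Continuous F := by
    simp only [F, partitionFn_eq_sum]
    refine continuous_finsetSum _ fun s _ => ?_
    split_ifs
    · refine continuous_finsetProd _ fun i _ => continuous_finsetProd _ fun j _ => ?_
      exact continuous_vertexWeight ω (by fun_prop) (by fun_prop) _ _ _ _
    · exact continuous_const
  have hG : ∀ f : ℕ → ℕ, Continuous fun t : ℝ => geomDifferenceProd ((t : ℂ) ^ 2) n f := fun f => by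
    unfold geomDifferenceProd
    fun_prop
  have hL : Continuous fun t : ℝ => F t * geomDifferenceProd ((t : ℂ) ^ 2) n id ^ 2 :=
    hF.mul ((hG _).pow 2)
  have hR : Continuous fun t : ℝ => ((ε : ℤ) : ℂ) *
      (geomDifferenceProd ((t : ℂ) ^ 2) n (fun k => (3 * k + 1) / 2) *
        geomDifferenceProd ((t : ℂ) ^ 2) n (fun k => 3 * k / 2)) :=
    continuous_const.mul ((hG _).mul (hG _))
  have heq : ∀ t ∈ Set.Ioi (1 : ℝ), F t * geomDifferenceProd ((t : ℂ) ^ 2) n id ^ 2 =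
      ((ε : ℤ) : ℂ) * (geomDifferenceProd ((t : ℂ) ^ 2) n (fun k => (3 * k + 1) / 2) *
        geomDifferenceProd ((t : ℂ) ^ 2) n (fun k => 3 * k / 2)) := by
    intro t ht
    have ht : 1 < t := ht
    have h0 : ∀ m : ℕ, 0 < (t ^ m) ^ 3 := fun m => by positivity
    -- For real `t > 1` the cubes of `± t ^ i` are distinct, so the closed form applies.
    have hinj : ∀ i j : Fin n, (t ^ i.val) ^ 3 = (t ^ j.val) ^ 3 → i = j := by
      intro i j h
      have h' : t ^ i.val = t ^ j.val :=
        (pow_left_inj₀ (by positivity) (by positivity) (by norm_num)).mp h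
      exact Fin.ext ((pow_right_inj₀ (by positivity) ht.ne').mp h')
    have h := hε (fun i => (t : ℂ) ^ i.val) ?_ ?_
    · have hmat : ∀ f : ℕ → ℕ,
          (Matrix.of fun i k : Fin n => (((t : ℂ) ^ i.val) ^ 2) ^ f k.val).det =
          (vandermonde fun k : Fin n => ((t : ℂ) ^ 2) ^ f k.val).det := by
        intro f
        rw [← det_transpose]
        congr 1
        ext i k
        simp only [transpose_apply, Matrix.of_apply, vandermonde_apply, ← pow_mul]
        congr 1
        ring
      have hid : (vandermonde fun i : Fin n => ((t : ℂ) ^ i.val) ^ 2).det =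
          (vandermonde fun k : Fin n => ((t : ℂ) ^ 2) ^ id k.val).det := by
        congr 2
        ext i
        rw [id, ← pow_mul, ← pow_mul, mul_comm]
      rw [hmat (fun k => (3 * k + 1) / 2), hmat (fun k => 3 * k / 2), hid, det_vandermonde_pow,
        det_vandermonde_pow _ _ (fun k => (3 * k + 1) / 2),
        det_vandermonde_pow _ _ (fun k => 3 * k / 2)] at h
      have hne : (t : ℂ) ^ 2 - 1 ≠ 0 := by
        have : t ^ 2 - 1 ≠ 0 := by nlinarith
        exact_mod_cast this
      have hN : (∏ i : Fin n, ∏ _j ∈ Finset.Ioi i, ((t : ℂ) ^ 2 - 1)) ≠ 0 :=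
        Finset.prod_ne_zero_iff.mpr fun i _ => Finset.prod_ne_zero_iff.mpr fun j _ => hne
      apply mul_left_cancel₀ (pow_ne_zero 2 hN)
      have hFt : F t = partitionFn ω (List.ofFn fun i : Fin n => (t : ℂ) ^ i.val)
        (-fun i : Fin n => (t : ℂ) ^ i.val) := rfl
      rw [hFt]
      linear_combination h
    · rintro (i | i) (j | j) h <;>
        simp only [Sum.elim_inl, Sum.elim_inr, Pi.neg_apply] at h
      · rw [hinj i j (by exact_mod_cast h)]
      · have h' : (t ^ i.val) ^ 3 = (-t ^ j.val) ^ 3 := by exact_mod_cast h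
        have := h0 i; have := h0 j
        rw [Odd.neg_pow (by decide)] at h'
        linarith
      · have h' : (-t ^ i.val) ^ 3 = (t ^ j.val) ^ 3 := by exact_mod_cast h
        have := h0 i; have := h0 j
        rw [Odd.neg_pow (by decide)] at h'
        linarith
      · rw [Odd.neg_pow (by decide), Odd.neg_pow (by decide), neg_inj] at h
        rw [hinj i j (by exact_mod_cast h)]
    · intro i
      exact pow_ne_zero _ (by exact_mod_cast (by positivity))
  have hlim := Set.EqOn.closure heq hL hR (x := 1) (by rw [closure_Ioi]; exact Set.self_mem_Ici)
  have hF1 : F 1 = asmEnum n (3 : ℂ) := by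
    rw [← partitionFn_one_neg_one hω]
    simp [F]
  simpa only [hF1, Complex.ofReal_one, one_pow] using hlim

/-! ### Evaluation of the products of differences -/

theorem prod_fin_Ioi_succ {M : Type*} [CommMonoid M] (n : ℕ) (g : ℕ → ℕ → M) :
    ∏ i : Fin (n + 1), ∏ j ∈ Finset.Ioi i, g i j =
      (∏ i : Fin n, ∏ j ∈ Finset.Ioi i, g i j) * ∏ i ∈ Finset.range n, g i n := by
  have h : ∀ (m : ℕ) (i : Fin m), ∏ j ∈ Finset.Ioi i, g i j = ∏ j, if i < j then g i j else 1 := by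
    intro m i
    rw [← Finset.prod_filter]
    congr 1
    ext j
    simp
  simp only [h, Fin.prod_univ_castSucc, Fin.castSucc_lt_castSucc_iff, Fin.castSucc_lt_last, if_true,
    Fin.val_castSucc, Fin.val_last, lt_irrefl, if_false, mul_one, Finset.prod_mul_distrib]
  have hl : ∀ j : Fin n, ¬ Fin.last n < j.castSucc := fun j => (Fin.castSucc_lt_last j).not_gt
  simp only [hl, if_false, Finset.prod_const_one, mul_one, Finset.prod_range]

theorem geomDifferenceProd_one_succ (n : ℕ) (f : ℕ → ℕ) :
    geomDifferenceProd (1 : ℚ) (n + 1) f =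
      geomDifferenceProd (1 : ℚ) n f * ∏ i ∈ Finset.range n, ((f n : ℚ) - f i) := by
  have h := prod_fin_Ioi_succ n fun i j => ((f j : ℚ) - f i)
  simpa [geomDifferenceProd] using h

theorem geomDifferenceProd_one_pos {f : ℕ → ℕ} (hf : StrictMono f) (n : ℕ) :
    0 < geomDifferenceProd (1 : ℚ) n f := by
  induction n with
  | zero => simp [geomDifferenceProd]
  | succ n ih =>
    rw [geomDifferenceProd_one_succ]
    refine mul_pos ih (Finset.prod_pos fun i hi => ?_)
    rw [sub_pos]
    exact_mod_cast hf (Finset.mem_range.mp hi)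

/-- The sign is determined by positivity. -/
theorem asmEnum_three_mul (n : ℕ) :
    asmEnum n (3 : ℚ) * geomDifferenceProd (1 : ℚ) n id ^ 2 =
      geomDifferenceProd (1 : ℚ) n (fun k => (3 * k + 1) / 2) *
        geomDifferenceProd (1 : ℚ) n (fun k => 3 * k / 2) := by
  obtain ⟨ε, h⟩ := exists_unit_asmEnum_three n
  have hA : asmEnum n (3 : ℂ) = ((asmEnum n (3 : ℚ) : ℚ) : ℂ) := by simp [asmEnum]
  have hG : ∀ f : ℕ → ℕ, geomDifferenceProd (1 : ℂ) n f =
      ((geomDifferenceProd (1 : ℚ) n f : ℚ) : ℂ) := fun f => by simp [geomDifferenceProd]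
  rw [hA, hG, hG, hG] at h
  have h' : asmEnum n (3 : ℚ) * geomDifferenceProd (1 : ℚ) n id ^ 2 =
      ((ε : ℤ) : ℚ) * (geomDifferenceProd (1 : ℚ) n (fun k => (3 * k + 1) / 2) *
        geomDifferenceProd (1 : ℚ) n (fun k => 3 * k / 2)) := by exact_mod_cast h
  have h0 : 0 ≤ asmEnum n (3 : ℚ) * geomDifferenceProd (1 : ℚ) n id ^ 2 :=
    mul_nonneg (Finset.sum_nonneg fun M _ => by positivity) (by positivity)
  have h1 := geomDifferenceProd_one_pos (f := fun k => (3 * k + 1) / 2)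
    (strictMono_nat_of_lt_succ fun k => by omega) n
  have h2 := geomDifferenceProd_one_pos (f := fun k => 3 * k / 2)
    (strictMono_nat_of_lt_succ fun k => by omega) n
  have h3 := mul_pos h1 h2
  rcases Int.units_eq_one_or ε with rfl | rfl
  · simpa using h'
  · simp at h'
    linarith

theorem asmEnum_three_succ (n : ℕ) :
    asmEnum (n + 1) (3 : ℚ) * (n ! : ℚ) ^ 2 = asmEnum n (3 : ℚ) *
      ∏ i ∈ Finset.range n, ((((3 * n + 1) / 2 : ℕ) : ℚ) - ((3 * i + 1) / 2 : ℕ)) *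
        (((3 * n / 2 : ℕ) : ℚ) - (3 * i / 2 : ℕ)) := by
  have h := asmEnum_three_mul (n + 1)
  have h' := asmEnum_three_mul n
  -- The differences `n - i` for the exponents of the Vandermonde product.
  have hid : ∏ i ∈ Finset.range n, (((id n : ℕ) : ℚ) - (id i : ℕ)) = n ! := by
    rw [← Finset.prod_range_reflect, ← Finset.prod_range_add_one_eq_factorial, Nat.cast_prod]
    refine Finset.prod_congr rfl fun i hi => ?_
    have := Finset.mem_range.mp hi
    rw [id, id, ← Nat.cast_sub (by omega)]
    congr 1
    omega
  rw [geomDifferenceProd_one_succ, geomDifferenceProd_one_succ, geomDifferenceProd_one_succ,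
    hid] at h
  have hpos := geomDifferenceProd_one_pos strictMono_id n
  apply mul_right_cancel₀ (pow_ne_zero 2 hpos.ne')
  rw [Finset.prod_mul_distrib]
  linear_combination h - (∏ i ∈ Finset.range n,
    ((((3 * n + 1) / 2 : ℕ) : ℚ) - ((3 * i + 1) / 2 : ℕ))) * (∏ i ∈ Finset.range n,
        (((3 * n / 2 : ℕ) : ℚ) - (3 * i / 2 : ℕ))) * h'

theorem prod_range_two_mul {M : Type*} [CommMonoid M] (f : ℕ → M) (m : ℕ) :
    ∏ i ∈ Finset.range (2 * m), f i = ∏ j ∈ Finset.range m, f (2 * j) * f (2 * j + 1) := by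
  induction m with
  | zero => simp
  | succ m ih =>
    rw [Finset.prod_range_succ, ← ih, show 2 * (m + 1) = 2 * m + 1 + 1 by ring,
      Finset.prod_range_succ, Finset.prod_range_succ, mul_assoc]

/-- The ratio of consecutive values from even to odd size. -/
theorem asmEnum_three_odd (m : ℕ) :
    asmEnum (2 * m + 1) (3 : ℚ) * ((2 * m)! : ℚ) ^ 2 =
      asmEnum (2 * m) (3 : ℚ) * (3 ^ m * (m ! : ℚ) * ((3 * m)! : ℚ)) := by
  rw [asmEnum_three_succ, prod_range_two_mul, ← Finset.prod_range_reflect]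
  congr 1
  have h : ∀ j ∈ Finset.range m, ((((3 * (2 * m) + 1) / 2 : ℕ) : ℚ) -
      ((3 * (2 * (m - 1 - j)) + 1) / 2 : ℕ)) *
        (((3 * (2 * m) / 2 : ℕ) : ℚ) - (3 * (2 * (m - 1 - j)) / 2 : ℕ)) *
      (((((3 * (2 * m) + 1) / 2 : ℕ) : ℚ) - ((3 * (2 * (m - 1 - j) + 1) + 1) / 2 : ℕ)) *
        (((3 * (2 * m) / 2 : ℕ) : ℚ) - (3 * (2 * (m - 1 - j) + 1) / 2 : ℕ))) =
      (3 * j + 3) * (3 * j + 3) * ((3 * j + 1) * (3 * j + 2)) := by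
    intro j hj
    obtain ⟨r, rfl⟩ : ∃ r, m = r + j + 1 := ⟨m - 1 - j, by have := Finset.mem_range.mp hj; omega⟩
    rw [show r + j + 1 - 1 - j = r by omega,
      show (3 * (2 * (r + j + 1)) + 1) / 2 = 3 * (r + j + 1) by omega,
      show 3 * (2 * (r + j + 1)) / 2 = 3 * (r + j + 1) by omega,
      show (3 * (2 * r) + 1) / 2 = 3 * r by omega, show 3 * (2 * r) / 2 = 3 * r by omega,
      show (3 * (2 * r + 1) + 1) / 2 = 3 * r + 2 by omega,
      show 3 * (2 * r + 1) / 2 = 3 * r + 1 by omega]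
    push_cast
    ring
  rw [Finset.prod_congr rfl h]
  clear h
  induction m with
  | zero => simp
  | succ m ih =>
    rw [Finset.prod_range_succ, ih, show 3 * (m + 1) = 3 * m + 1 + 1 + 1 by ring]
    simp only [Nat.factorial_succ]
    push_cast
    ring

/-- The ratio of consecutive values from odd to even size. -/
theorem asmEnum_three_even (m : ℕ) :
    asmEnum (2 * m + 2) (3 : ℚ) * ((2 * m + 1)! : ℚ) ^ 2 =
      asmEnum (2 * m + 1) (3 : ℚ) * (3 ^ m * (m ! : ℚ) * ((3 * m + 2)! : ℚ)) := by
  rw [asmEnum_three_succ, Finset.prod_range_succ, prod_range_two_mul, ← Finset.prod_range_reflect]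
  congr 1
  have h : ∀ j ∈ Finset.range m, ((((3 * (2 * m + 1) + 1) / 2 : ℕ) : ℚ) -
      ((3 * (2 * (m - 1 - j)) + 1) / 2 : ℕ)) *
        (((3 * (2 * m + 1) / 2 : ℕ) : ℚ) - (3 * (2 * (m - 1 - j)) / 2 : ℕ)) *
      (((((3 * (2 * m + 1) + 1) / 2 : ℕ) : ℚ) - ((3 * (2 * (m - 1 - j) + 1) + 1) / 2 : ℕ)) *
        (((3 * (2 * m + 1) / 2 : ℕ) : ℚ) - (3 * (2 * (m - 1 - j) + 1) / 2 : ℕ))) =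
      (3 * j + 5) * (3 * j + 4) * ((3 * j + 3) * (3 * j + 3)) := by
    intro j hj
    obtain ⟨r, rfl⟩ : ∃ r, m = r + j + 1 := ⟨m - 1 - j, by have := Finset.mem_range.mp hj; omega⟩
    rw [show r + j + 1 - 1 - j = r by omega,
      show (3 * (2 * (r + j + 1) + 1) + 1) / 2 = 3 * (r + j + 1) + 2 by omega,
      show 3 * (2 * (r + j + 1) + 1) / 2 = 3 * (r + j + 1) + 1 by omega,
      show (3 * (2 * r) + 1) / 2 = 3 * r by omega, show 3 * (2 * r) / 2 = 3 * r by omega,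
      show (3 * (2 * r + 1) + 1) / 2 = 3 * r + 2 by omega,
      show 3 * (2 * r + 1) / 2 = 3 * r + 1 by omega]
    push_cast
    ring
  have hlast : ((((3 * (2 * m + 1) + 1) / 2 : ℕ) : ℚ) - ((3 * (2 * m) + 1) / 2 : ℕ)) *
      (((3 * (2 * m + 1) / 2 : ℕ) : ℚ) - (3 * (2 * m) / 2 : ℕ)) = 2 := by
    rw [show (3 * (2 * m + 1) + 1) / 2 = 3 * m + 2 by omega,
      show 3 * (2 * m + 1) / 2 = 3 * m + 1 by omega,
      show (3 * (2 * m) + 1) / 2 = 3 * m by omega, show 3 * (2 * m) / 2 = 3 * m by omega]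
    push_cast
    ring
  rw [Finset.prod_congr rfl h, hlast]
  clear h hlast
  induction m with
  | zero => simp
  | succ m ih =>
    rw [Finset.prod_range_succ, mul_right_comm, ih,
      show 3 * (m + 1) + 2 = 3 * m + 2 + 1 + 1 + 1 by ring]
    simp only [Nat.factorial_succ]
    push_cast
    ring

theorem asmEnum_one : asmEnum 1 (3 : ℚ) = 1 := by
  have h := asmEnum_three_mul 1
  simpa [geomDifferenceProd] using h

theorem prod_Icc_factorial_shift (n : ℕ) :
    (∏ i ∈ Finset.Icc (n + 1 + 1) (2 * (n + 1)), (i ! : ℚ)) * ((n + 1)! : ℚ) =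
      (∏ i ∈ Finset.Icc (n + 1) (2 * n), (i ! : ℚ)) * ((2 * n + 1)! : ℚ) * ((2 * n + 2)! : ℚ) := by
  rw [← Finset.prod_Icc_succ_top (by omega), ← Finset.prod_Icc_succ_top (by omega),
    ← Finset.mul_prod_Ioc_eq_prod_Icc (a := n + 1) (b := 2 * n + 1 + 1) (by omega), mul_comm]
  congr 2
  ext i
  simp only [Finset.mem_Icc, Finset.mem_Ioc]
  omega

theorem theorem2 :
    (∀ n : ℕ,
      asmEnum (2 * n + 1) (3 : ℚ) =
        (3 ^ (n * (n + 1) / 2) *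
          (∏ i ∈ Finset.Icc 1 n, ((3 * i - 1)! : ℚ)) /
            ∏ i ∈ Finset.Icc (n + 1) (2 * n), (i ! : ℚ)) ^ 2) ∧
    (∀ n : ℕ, 1 ≤ n →
      asmEnum (2 * n) (3 : ℚ) =
        3 ^ (n - 1) * (((3 * n - 1)! : ℚ) * ((n - 1)! : ℚ) / ((2 * n - 1)! : ℚ) ^ 2) *
          asmEnum (2 * n - 1) (3 : ℚ)) := by
  have hfac : ∀ k : ℕ, (k ! : ℚ) ≠ 0 := fun k => by exact_mod_cast k.factorial_ne_zero
  refine ⟨fun n => ?_, fun n hn => ?_⟩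
  · induction n with
    | zero => simp [asmEnum_one]
    | succ n ih =>
      have h1 := asmEnum_three_odd (n + 1)
      have h2 := asmEnum_three_even n
      have h3 := prod_Icc_factorial_shift n
      have hD : (∏ i ∈ Finset.Icc (n + 1) (2 * n), (i ! : ℚ)) ≠ 0 :=
        Finset.prod_ne_zero_iff.mpr fun i _ => hfac i
      have hD' : (∏ i ∈ Finset.Icc (n + 1 + 1) (2 * (n + 1)), (i ! : ℚ)) ≠ 0 :=
        Finset.prod_ne_zero_iff.mpr fun i _ => hfac i
      rw [Finset.prod_Icc_succ_top (by omega), show (n + 1) * (n + 1 + 1) / 2 =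
        n * (n + 1) / 2 + (n + 1) by
          rw [show (n + 1) * (n + 1 + 1) = n * (n + 1) + (n + 1) * 2 by ring,
            Nat.add_mul_div_right _ _ (by norm_num)], pow_add,
        show 3 * (n + 1) - 1 = 3 * n + 2 by omega]
      rw [show 2 * (n + 1) = 2 * n + 2 by ring] at h1 h3 hD' ⊢
      rw [show 3 * (n + 1) = 3 * n + 2 + 1 by ring, Nat.factorial_succ (3 * n + 2),
        Nat.factorial_succ n] at h1
      rw [Nat.factorial_succ n] at h3
      rw [ih] at h2
      have hn1 : (n : ℚ) + 1 ≠ 0 := by positivity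
      have hf := hfac n
      have hf1 := hfac (2 * n + 1)
      have hf2 := hfac (2 * n + 2)
      push_cast at h1 h3
      rw [← eq_div_iff (by positivity)] at h1 h2 h3
      rw [h1, h2, h3]
      field_simp
      ring
  · obtain ⟨m, rfl⟩ : ∃ m, n = m + 1 := ⟨n - 1, by omega⟩
    have h := asmEnum_three_even m
    rw [show 2 * (m + 1) = 2 * m + 2 by ring, show 2 * m + 2 - 1 = 2 * m + 1 by omega,
      show m + 1 - 1 = m by omega, show 3 * (m + 1) - 1 = 3 * m + 2 by omega]
    have := hfac (2 * m + 1)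
    field_simp
    linear_combination h
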